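/- Let $X$ be a complex manifold (finite-dimensional, Hausdorff, second countable), and let $\Omega\subsetneq X$ be a domain, i.e. a non-empty connected open subset, with Kobayashi pseudodistance $\mathsf{k}_\Omega$. Write $\overline\Omega$ and $\partial\Omega$ for its closure and boundary in $X$. Fix an exhaustion $(K_j)_{j}$ of $\overline\Omega$ by compact sets with $K_j\subset \mathrm{int}(K_{j+1})$. An end of $\overline\Omega$ is a sequence $e=(F_j)_j$ such that $F_j$ is a connected component of $\overline\Omega\setminus K_j$ and $F_{j+1}\subset F_j$ for all $j$. The end compactification $\overline\Omega^{\mathrm{End}}$ is the disjoint union of $\overline\Omega$ and the set of its ends, with the following topology: a set $U$ is open if $U\cap\overline\Omega$ is open in $\overline\Omega$ and if for every end $e=(F_j)_j$ in $U$ there is a $j$ such that $U$ contains $F_j$ and all ends $(G_\nu)_\nu$ with $G_\nu=F_\nu$ for $\nu\le j$. Put $\partial\overline\Omega^{\mathrm{End}}:=\overline\Omega^{\mathrm{End}}\setminus\Omega$. For $p\in\Omega$, $x\in\partial\overline\Omega^{\mathrm{End}}$ and $R>0$ the big horosphere is $$H^b_p(x,R):=\Big\{z\in\Omega:\ \liminf_{w\to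 x}\big(\mathsf{k}_\Omega(z,w)-\mathsf{k}_\Omega(p,w)\big)<\tfrac12\log R\Big\},$$ where $w$ tends to $x$ within $\Omega$ in the topology of $\overline\Omega^{\mathrm{End}}$. Assume that $\overline\Omega^{\mathrm{End}}$ is sequentially compact, that $\Omega$ is complete Kobayashi hyperbolic (i.e. $\mathsf{k}_\Omega$ is a distance and $(\Omega,\mathsf{k}_\Omega)$ is a complete metric space), and that $$\lim_{(z,w)\to(x,y)}\mathsf{k}_\Omega(z,w)=\infty\qquad\text{for all } x\neq y\in\partial\Omega .$$ Assume moreover that, for some fixed $p\in\Omega$ and for every $x\in\partial\overline\Omega^{\mathrm{End}}$, the set $$\bigcap_{R>0}\overline{H^b_p(x,R)}\qquad(\text{closures taken in }\overline\Omega^{\mathrm{End}})$$ is a singleton. Then for every holomorphic map $f:\Omega\to\Omega$ one of the following holds: (a) for each $z\in\Omega$ the orbit $\{f^n(z):n\in\mathbb{N}\}$ is relatively compact in $\Omega$; (b) there is a point $y\in\partial\overline\Omega^{\mathrm{End}}$ such that $f^n\to y$ in the compact-open topology, as maps from $\Omega$ to $\overline\Omega^{\mathrm{End}}$. -/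

import Mathlib

open Set Filter Topology TopologicalSpace
open scoped Manifold ContDiff ComplexConjugate

/-! ### The Kobayashi distance -/

/-- The Poincaré distance of the unit disc (curvature `-4`):
`artanh |(ζ - η) / (1 - conj ζ * η)| = (1/2) log ((1 + ρ) / (1 - ρ))`. -/
noncomputable def poincareDist (ζ η : ℂ) : ℝ :=
  Real.artanh ‖(ζ - η) / (1 - conj ζ * η)‖

/-- `DiscChain E z w L`: the points `z`, `w` of the complex manifold `M` are joined by a finite
chain of holomorphic discs whose Poincaré lengths add up to `L`. -/
inductive DiscChain (E : Type*) [NormedAddCommGroup E] [NormedSpace ℂ E]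
    {M : Type*} [TopologicalSpace M] [ChartedSpace E M] : M → M → ℝ → Prop
  | nil (z : M) : DiscChain E z z 0
  | cons (φ : ℂ → M) (hφ : MDifferentiableOn 𝓘(ℂ) 𝓘(ℂ, E) φ (Metric.ball 0 1))
      (ζ η : ℂ) (hζ : ζ ∈ Metric.ball (0 : ℂ) 1) (hη : η ∈ Metric.ball (0 : ℂ) 1)
      (w : M) (L : ℝ) (h : DiscChain E (φ η) w L) :
      DiscChain E (φ ζ) w (poincareDist ζ η + L)

/-- The Kobayashi pseudodistance of a connected complex manifold `M` modelled on `E`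
(any two points of a connected manifold are joined by a chain of discs). -/
noncomputable def kobayashiDist (E : Type*) [NormedAddCommGroup E] [NormedSpace ℂ E]
    {M : Type*} [TopologicalSpace M] [ChartedSpace E M] (z w : M) : ℝ :=
  sInf {L : ℝ | DiscChain E z w L}

/-- `M` is Kobayashi hyperbolic: the Kobayashi pseudodistance separates points. -/
def KobayashiHyperbolic (E : Type*) [NormedAddCommGroup E] [NormedSpace ℂ E]
    (M : Type*) [TopologicalSpace M] [ChartedSpace E M] : Prop :=
  ∀ z w : M, kobayashiDist E z w = 0 → z = w

/-- Every Cauchy sequence for the Kobayashi distance converges for the Kobayashi distance. -/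
def KobayashiComplete (E : Type*) [NormedAddCommGroup E] [NormedSpace ℂ E]
    (M : Type*) [TopologicalSpace M] [ChartedSpace E M] : Prop :=
  ∀ u : ℕ → M,
    (∀ ε > 0, ∃ N, ∀ m ≥ N, ∀ n ≥ N, kobayashiDist E (u m) (u n) < ε) →
    ∃ z : M, Tendsto (fun n => kobayashiDist E (u n) z) atTop (𝓝 0)

/-! ### The end compactification -/

/-- An end of `Y`, relative to a compact exhaustion `K`: a decreasing sequence whose `j`-th term
is a connected component of `Y \ K j`. -/
structure SpaceEnd {Y : Type*} [TopologicalSpace Y] (K : CompactExhaustion Y) where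
  /-- the sequence of components -/
  comp : ℕ → Set Y
  isComponent : ∀ j, ∃ y ∈ (K j)ᶜ, comp j = connectedComponentIn (K j)ᶜ y
  succ_subset : ∀ j, comp (j + 1) ⊆ comp j

/-- The end compactification: the disjoint union of `Y` and its set of ends. -/
inductive EndCompactification {Y : Type*} [TopologicalSpace Y] (K : CompactExhaustion Y)
  | ofPoint (y : Y) : EndCompactification K
  | ofEnd (e : SpaceEnd K) : EndCompactification K

namespace EndCompactification

/-- The `j`-th basic neighbourhood of the end `e`: the component `e.comp j` together with all ends
whose components agree with those of `e` up to the index `j`. -/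
def basicNhd {Y : Type*} [TopologicalSpace Y] {K : CompactExhaustion Y} (e : SpaceEnd K) (j : ℕ) :
    Set (EndCompactification K) :=
  ofPoint '' e.comp j ∪ ofEnd '' {g | ∀ i ≤ j, g.comp i = e.comp i}

theorem basicNhd_anti {Y : Type*} [TopologicalSpace Y] {K : CompactExhaustion Y} (e : SpaceEnd K)
    {i j : ℕ} (h : i ≤ j) : basicNhd e j ⊆ basicNhd e i :=
  union_subset_union (image_mono (antitone_nat_of_succ_le e.succ_subset h))
    (image_mono fun _ hg k hk => hg k (hk.trans h))

/-- A set is open if its trace on `Y` is open and it contains a basic neighbourhood of each of its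
ends. -/
instance {Y : Type*} [TopologicalSpace Y] (K : CompactExhaustion Y) :
    TopologicalSpace (EndCompactification K) where
  IsOpen U := IsOpen (ofPoint ⁻¹' U) ∧ ∀ e, ofEnd e ∈ U → ∃ j, basicNhd e j ⊆ U
  isOpen_univ := ⟨isOpen_univ, fun _ _ => ⟨0, subset_univ _⟩⟩
  isOpen_inter := by
    rintro U V ⟨hU, hU'⟩ ⟨hV, hV'⟩
    refine ⟨hU.inter hV, fun e he => ?_⟩
    obtain ⟨i, hi⟩ := hU' e he.1
    obtain ⟨j, hj⟩ := hV' e he.2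
    exact ⟨max i j, subset_inter ((basicNhd_anti e (le_max_left i j)).trans hi)
      ((basicNhd_anti e (le_max_right i j)).trans hj)⟩
  isOpen_sUnion := by
    intro S hS
    refine ⟨?_, fun e he => ?_⟩
    · rw [preimage_sUnion]
      exact isOpen_biUnion fun U hU => (hS U hU).1
    · obtain ⟨U, hU, heU⟩ := he
      obtain ⟨j, hj⟩ := (hS U hU).2 e heU
      exact ⟨j, hj.trans (subset_sUnion_of_mem hU)⟩

theorem continuous_ofPoint {Y : Type*} [TopologicalSpace Y] (K : CompactExhaustion Y) :
    Continuous (ofPoint : Y → EndCompactification K) :=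
  ⟨fun _ hU => hU.1⟩

end EndCompactification

/-- The inclusion of a domain `Ω` in the end compactification of its closure. -/
def endInclusion {X : Type*} [TopologicalSpace X] (Ω : Opens X)
    (K : CompactExhaustion (closure (Ω : Set X))) : C(Ω, EndCompactification K) where
  toFun z := .ofPoint ⟨z, subset_closure z.2⟩
  continuous_toFun := (EndCompactification.continuous_ofPoint K).comp (by fun_prop)

/-- The boundary of `Ω` in the end compactification of its closure. -/
def endBoundary {X : Type*} [TopologicalSpace X] (Ω : Opens X)
    (K : CompactExhaustion (closure (Ω : Set X))) : Set (EndCompactification K) :=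
  (range (endInclusion Ω K))ᶜ

/-! ### Boundary divergence and big horospheres -/

/-- `k_Ω(z, w) → ∞` as `(z, w) → (x, y)`, for all pairs of distinct points `x`, `y` of the
boundary of `Ω` in `X`. -/
def BoundaryDivergence (E : Type*) [NormedAddCommGroup E] [NormedSpace ℂ E]
    {X : Type*} [TopologicalSpace X] [ChartedSpace E X] (Ω : Opens X) : Prop :=
  ∀ x ∈ frontier (Ω : Set X), ∀ y ∈ frontier (Ω : Set X), x ≠ y →
    Tendsto (fun q : Ω × Ω => kobayashiDist E q.1 q.2)
      (comap Subtype.val (𝓝 x) ×ˢ comap Subtype.val (𝓝 y)) atTop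

/-- The big horosphere with pole `p`, centre `x` and radius `R`: the set of all `z ∈ Ω` with
`liminf_{w → x} (k_Ω(z, w) - k_Ω(p, w)) < (1/2) log R`. -/
noncomputable def bigHorosphere (E : Type*) [NormedAddCommGroup E] [NormedSpace ℂ E]
    {X : Type*} [TopologicalSpace X] [ChartedSpace E X] (Ω : Opens X)
    (K : CompactExhaustion (closure (Ω : Set X))) (p : Ω) (x : EndCompactification K) (R : ℝ) :
    Set Ω :=
  {z | liminf (fun w : Ω => ((kobayashiDist E z w - kobayashiDist E p w : ℝ) : EReal))
      (comap (endInclusion Ω K) (𝓝 x)) < ((1 / 2 * Real.log R : ℝ) : EReal)}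

/-!
The Kobayashi distance of a complete hyperbolic manifold is a length metric inducing the manifold
topology, so closed balls are compact (Hopf–Rinow). By Całka's theorem, either all orbits of the
nonexpansive map `f` are bounded, or `f^n p` leaves every compact set.

In the second case let `f^n p` accumulate at `x` along times at which `d(p, f^n p)` is larger than
ever before. Seen from `f^m p`, these record points are eventually no farther away than from `p`, so
walking a fixed distance from `f^m p` towards them leads into any prescribed big horosphere at `x`.
Thus the whole orbit stays within bounded distance of each big horosphere at `x`. By boundary
divergence, disc chains of bounded length that escape to infinity shrink to points of the end
compactification: hence two sequences in `Ω` at bounded distance have the same limits in the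
boundary, and every limit of the orbit lies in the closure of each big horosphere at `x`. These
closures have a single point in common, so the orbit of `p` converges, and so do all the others.
-/

/-! ### Length metrics -/

section LengthMetric

variable {M : Type*} [PseudoMetricSpace M]

/-- Almost geodesic (pseudo)metrics: a point at distance `r` from `a` can be chosen on an almost
shortest way from `a` to `b`. For complete spaces this says that `M` is a length space. -/
def IsLengthMetric (M : Type*) [PseudoMetricSpace M] : Prop :=
  ∀ (a b : M) (r : ℝ), 0 ≤ r → r ≤ dist a b →
    ∀ ε > 0, ∃ v, dist a v ≤ r ∧ dist v b < dist a b - r + ε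

theorem IsLengthMetric.ball_subset_thickening (hM : IsLengthMetric M) (z : M) {s : ℝ}
    (hs : 0 ≤ s) {δ : ℝ} (hδ : 0 < δ) :
    Metric.ball z (s + δ) ⊆ Metric.thickening δ (Metric.closedBall z s) := by
  intro w hw
  rw [Metric.mem_thickening_iff]
  rcases le_total (dist w z) s with h | h
  · exact ⟨w, h, by rwa [dist_self]⟩
  · rw [Metric.mem_ball] at hw
    obtain ⟨v, hzv, hvw⟩ :=
      hM z w s hs (by rwa [dist_comm]) (s + δ - dist w z) (sub_pos.2 hw)
    rw [dist_comm z w, dist_comm v w] at hvw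
    exact ⟨v, by rwa [Metric.mem_closedBall, dist_comm], by linarith⟩

theorem IsLengthMetric.isCompact_closedBall_of_forall_lt [CompleteSpace M]
    (hM : IsLengthMetric M) {z : M} {R : ℝ}
    (h : ∀ s < R, IsCompact (Metric.closedBall z s)) : IsCompact (Metric.closedBall z R) := by
  refine isCompact_iff_totallyBounded_isComplete.2 ⟨?_, Metric.isClosed_closedBall.isComplete⟩
  rw [Metric.totallyBounded_iff]
  intro ε hε
  rcases le_or_gt R 0 with hR | hR
  · refine ⟨{z}, finite_singleton z, ?_⟩
    rw [biUnion_singleton]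
    exact Metric.closedBall_subset_ball (hR.trans_lt hε)
  set δ := min (ε / 4) R
  have hδ : 0 < δ := by positivity
  have hδε : δ ≤ ε / 4 := min_le_left _ _
  have hδR : δ ≤ R := min_le_right _ _
  obtain ⟨t, ht, hcover⟩ := Metric.totallyBounded_iff.1
    (h (R - δ) (sub_lt_self R hδ)).totallyBounded (ε / 2) (half_pos hε)
  refine ⟨t, ht, fun w hw => ?_⟩
  obtain ⟨v, hv, hwv⟩ := Metric.mem_thickening_iff.1 <|
    hM.ball_subset_thickening z (sub_nonneg.2 hδR) (half_pos hε)
      (Metric.closedBall_subset_ball (by linarith) hw)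
  obtain ⟨y, hy, hvy⟩ := mem_iUnion₂.1 (hcover hv)
  have hwy : dist w y < ε :=
    (dist_triangle w v y).trans_lt (by linarith [Metric.mem_ball.1 hvy])
  exact mem_iUnion₂.2 ⟨y, hy, hwy⟩

theorem IsLengthMetric.exists_isCompact_closedBall_add [LocallyCompactSpace M]
    (hM : IsLengthMetric M) {z : M} {R : ℝ} (hR : 0 ≤ R)
    (hc : IsCompact (Metric.closedBall z R)) :
    ∃ δ > 0, IsCompact (Metric.closedBall z (R + δ)) := by
  obtain ⟨δ, hδ, hδc⟩ := hc.exists_isCompact_cthickening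
  refine ⟨δ / 2, half_pos hδ, hδc.of_isClosed_subset Metric.isClosed_closedBall ?_⟩
  calc Metric.closedBall z (R + δ / 2)
      ⊆ Metric.ball z (R + δ) := Metric.closedBall_subset_ball (by linarith)
    _ ⊆ Metric.thickening δ (Metric.closedBall z R) := hM.ball_subset_thickening z hR hδ
    _ ⊆ Metric.cthickening δ (Metric.closedBall z R) := Metric.thickening_subset_cthickening _ _

/-- The Hopf–Rinow–Cohn-Vossen theorem. -/
theorem IsLengthMetric.properSpace [LocallyCompactSpace M] [CompleteSpace M]
    (hM : IsLengthMetric M) : ProperSpace M := by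
  refine ⟨fun z r => ?_⟩
  by_contra hr
  let S : Set ℝ := {s | ¬ IsCompact (Metric.closedBall z s)}
  have hS : ∀ s ∈ S, 0 ≤ s := fun s hs => by
    by_contra! h
    exact hs (by simp only [Metric.closedBall_eq_empty.2 h, isCompact_empty])
  have hcompact : IsCompact (Metric.closedBall z (sInf S)) :=
    hM.isCompact_closedBall_of_forall_lt fun s hs => not_not.1 (notMem_of_lt_csInf hs ⟨0, hS⟩)
  obtain ⟨δ, hδ, hδc⟩ := hM.exists_isCompact_closedBall_add (le_csInf ⟨r, hr⟩ hS) hcompact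
  obtain ⟨s, hs, hsδ⟩ := exists_lt_of_csInf_lt ⟨r, hr⟩ (lt_add_of_pos_right (sInf S) hδ)
  exact hs (hδc.of_isClosed_subset Metric.isClosed_closedBall
    (Metric.closedBall_subset_closedBall hsδ.le))

end LengthMetric

/-! ### Orbits of nonexpansive maps -/

section Nonexpansive

variable {M : Type*} [PseudoMetricSpace M] {f : M → M}

theorem dist_iterate_le (hf : LipschitzWith 1 f) (n : ℕ) (a b : M) :
    dist (f^[n] a) (f^[n] b) ≤ dist a b := by
  simpa using (hf.iterate n).dist_le_mul a b

theorem dist_iterate_le_of_le (hf : LipschitzWith 1 f) (p : M) {m n : ℕ} (hmn : m ≤ n) :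
    dist (f^[m] p) (f^[n] p) ≤ dist p (f^[n - m] p) := by
  simpa only [← Function.iterate_add_apply, Nat.add_sub_cancel' hmn] using
    dist_iterate_le hf m p (f^[n - m] p)

theorem exists_bounded_return_gaps [ProperSpace M] (hf : LipschitzWith 1 f) {p : M} {C : ℝ}
    (hC : ∃ᶠ n : ℕ in atTop, dist p (f^[n] p) ≤ C) :
    ∃ B, ∀ n, dist p (f^[n] p) ≤ C + 1 →
      ∃ k, 1 ≤ k ∧ k ≤ B ∧ dist p (f^[n + k] p) ≤ C + 1 := by
  let O : Set M := {y | ∃ n, f^[n] p = y ∧ dist p y ≤ C + 1}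
  have hO : TotallyBounded O :=
    (isCompact_closedBall p (C + 1)).totallyBounded.subset fun y ⟨_, _, hy⟩ => by
      rwa [Metric.mem_closedBall, dist_comm]
  obtain ⟨t, htO, htfin, hcover⟩ := Metric.finite_approx_of_totallyBounded hO 1 one_pos
  have hreturn : ∀ y ∈ t, ∃ k : ℕ, 1 ≤ k ∧ dist p (f^[k] y) ≤ C := by
    intro y hy
    obtain ⟨n, rfl, -⟩ := htO hy
    obtain ⟨q, hq, hqC⟩ := frequently_atTop.1 hC (n + 1)
    refine ⟨q - n, by omega, ?_⟩
    rwa [← Function.iterate_add_apply, Nat.sub_add_cancel (by omega)]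
  choose! k hk hkC using hreturn
  obtain ⟨B, hB⟩ := (htfin.image k).bddAbove
  refine ⟨B, fun n hn => ?_⟩
  obtain ⟨y, hy, hny⟩ := mem_iUnion₂.1 (hcover ⟨n, rfl, hn⟩)
  refine ⟨k y, hk y hy, hB ⟨y, hy, rfl⟩, ?_⟩
  calc dist p (f^[n + k y] p)
      ≤ dist p (f^[k y] y) + dist (f^[k y] y) (f^[k y] (f^[n] p)) := by
        rw [add_comm n, Function.iterate_add_apply]
        exact dist_triangle _ _ _
    _ ≤ C + 1 := add_le_add (hkC y hy) <|
        (dist_iterate_le hf _ _ _).trans (by rw [dist_comm]; exact (Metric.mem_ball.1 hny).le)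

theorem exists_mem_le_add_of_bounded_gaps {S : Set ℕ} {B : ℕ} (h0 : 0 ∈ S)
    (hS : ∀ n ∈ S, ∃ k, 1 ≤ k ∧ k ≤ B ∧ n + k ∈ S) (m : ℕ) : ∃ n ∈ S, n ≤ m ∧ m ≤ n + B := by
  induction m with
  | zero => exact ⟨0, h0, le_rfl, Nat.zero_le _⟩
  | succ m ih =>
    obtain ⟨n, hn, hnm, hmn⟩ := ih
    by_cases h : m + 1 ≤ n + B
    · exact ⟨n, hn, by omega, h⟩
    · obtain ⟨k, hk, hkB, hnk⟩ := hS n hn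
      exact ⟨n + k, hnk, by omega, by omega⟩

theorem exists_dist_iterate_le_of_frequently [ProperSpace M] (hf : LipschitzWith 1 f) {p : M}
    {C : ℝ} (hC : ∃ᶠ n : ℕ in atTop, dist p (f^[n] p) ≤ C) :
    ∃ C', ∀ n : ℕ, dist p (f^[n] p) ≤ C' := by
  obtain ⟨B, hB⟩ := exists_bounded_return_gaps hf hC
  obtain ⟨n₀, hn₀⟩ := hC.exists
  have hC0 : 0 ≤ C := dist_nonneg.trans hn₀
  have hstart : dist p (f^[0] p) ≤ C + 1 := by
    rw [Function.iterate_zero, id_eq, dist_self]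
    positivity
  obtain ⟨D, hD⟩ := ((finite_Iic B).image fun k => dist p (f^[k] p)).bddAbove
  refine ⟨C + 1 + D, fun m => ?_⟩
  obtain ⟨n, hn, hnm, hmn⟩ := exists_mem_le_add_of_bounded_gaps
    (S := {n | dist p (f^[n] p) ≤ C + 1}) hstart hB m
  calc dist p (f^[m] p) ≤ dist p (f^[n] p) + dist (f^[n] p) (f^[m] p) := dist_triangle _ _ _
    _ ≤ C + 1 + D := add_le_add hn <| (dist_iterate_le_of_le hf p hnm).trans
        (hD ⟨m - n, Nat.sub_le_iff_le_add'.2 hmn, rfl⟩)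

/-- Całka's theorem. -/
theorem isBounded_range_iterate_or_tendsto_dist_iterate [ProperSpace M] (hf : LipschitzWith 1 f)
    (p : M) :
    (∀ z, Bornology.IsBounded (range fun n : ℕ => f^[n] z)) ∨
      Tendsto (fun n : ℕ => dist p (f^[n] p)) atTop atTop := by
  refine or_iff_not_imp_right.2 fun h z => ?_
  obtain ⟨C, hC⟩ := not_forall.1 (mt tendsto_atTop.2 h)
  obtain ⟨C', hC'⟩ := exists_dist_iterate_le_of_frequently hf <|
    (not_eventually.1 hC).mono fun n hn => (not_le.1 hn).le
  refine (Metric.isBounded_iff_subset_closedBall p).2 ⟨C' + dist p z, ?_⟩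
  rintro _ ⟨n, rfl⟩
  rw [Metric.mem_closedBall, dist_comm]
  exact (dist_triangle _ _ _).trans (add_le_add (hC' n) (dist_iterate_le hf n p z))

end Nonexpansive

section Horoballs

variable {M Z : Type*} [PseudoMetricSpace M] [TopologicalSpace Z]

/-- The set of `z` with `liminf_{w → x} (d(z, w) - d(p, w)) < c`: the big horosphere of a metric
space `M` mapped to a space `Z` of ideal points by `ι`, its radius being `exp (2 * c)` in the usual
normalization. The values lie in `EReal` because `liminf` on `ℝ` is junk for unbounded functions. -/
noncomputable def bigHoroball (ι : M → Z) (p : M) (x : Z) (c : ℝ) : Set M :=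
  {z | liminf (fun w : M => ((dist z w - dist p w : ℝ) : EReal)) (comap ι (𝓝 x)) < (c : EReal)}

/-- `M` is small at infinity in `Z`: seen from an ideal point, sets of bounded size shrink to
points. -/
def IsSmallAtInfinity (ι : M → Z) : Prop :=
  ∀ y ∉ range ι, ∀ (v x : ℕ → M) (R : ℝ), (∀ i, dist (v i) (x i) ≤ R) →
    Tendsto (fun i => ι (v i)) atTop (𝓝 y) → Tendsto (fun i => ι (x i)) atTop (𝓝 y)

variable {ι : M → Z} {p : M} {x : Z} {c : ℝ}

theorem mem_bigHoroball_of_frequently {α : Type*} {l : Filter α} {w : α → M}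
    (hw : Tendsto (fun i => ι (w i)) l (𝓝 x)) {z : M} {b : ℝ} (hbc : b < c)
    (h : ∃ᶠ i in l, dist z (w i) - dist p (w i) ≤ b) : z ∈ bigHoroball ι p x c :=
  (liminf_le_of_frequently_le' <| (tendsto_comap_iff.2 hw).frequently <|
    h.mono fun _ hi => EReal.coe_le_coe_iff.2 hi).trans_lt (EReal.coe_lt_coe_iff.2 hbc)

theorem exists_mem_bigHoroball_dist_le [ProperSpace M] (hM : IsLengthMetric M)
    {α : Type*} {l : Filter α} [l.NeBot] {w : α → M} (hw : Tendsto (fun i => ι (w i)) l (𝓝 x))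
    {q : M} (hfar : Tendsto (fun i => dist q (w i)) l atTop)
    (hqp : ∀ᶠ i in l, dist q (w i) ≤ dist p (w i)) {r : ℝ} (hr : 0 ≤ r) (hcr : -c < r) :
    ∃ v ∈ bigHoroball ι p x c, dist q v ≤ r := by
  obtain ⟨ε, hε, hεc⟩ : ∃ ε > 0, -r + 2 * ε < c :=
    ⟨(r + c) / 3, by linarith, by linarith⟩
  -- points at distance `r` from `q` on almost shortest ways to `w i` accumulate in the horoball
  have hstep : ∀ i, r ≤ dist q (w i) →
      ∃ v, dist q v ≤ r ∧ dist v (w i) < dist q (w i) - r + ε :=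
    fun i hi => hM q (w i) r hr hi ε hε
  have : Nonempty M := ⟨q⟩
  choose! v hqv hvw using hstep
  have hr_far : ∀ᶠ i in l, r ≤ dist q (w i) := hfar.eventually_ge_atTop r
  obtain ⟨a, ha, hcluster⟩ := (isCompact_closedBall q r).exists_mapClusterPt_of_frequently
    (f := v) (hr_far.mono fun i hi => Metric.mem_closedBall'.2 (hqv i hi)).frequently
  refine ⟨a, mem_bigHoroball_of_frequently hw hεc ?_, Metric.mem_closedBall'.1 ha⟩
  refine ((hcluster.frequently (Metric.ball_mem_nhds a hε)).and_eventually
    (hr_far.and hqp)).mono ?_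
  rintro i ⟨hav, hir, hip⟩
  have hav : dist a (v i) < ε := Metric.mem_ball'.1 hav
  linarith [dist_triangle a (v i) (w i), hvw i hir]

theorem exists_mem_bigHoroball_dist_iterate_le [ProperSpace M] (hM : IsLengthMetric M)
    {f : M → M} (hf : LipschitzWith 1 f)
    (hesc : Tendsto (fun n : ℕ => dist p (f^[n] p)) atTop atTop)
    {α : Type*} {l : Filter α} [l.NeBot] {φ : α → ℕ} (hφ : Tendsto φ l atTop)
    (hrecord : ∀ i, ∀ k ≤ φ i, dist p (f^[k] p) ≤ dist p (f^[φ i] p))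
    (hx : Tendsto (fun i => ι (f^[φ i] p)) l (𝓝 x)) (c : ℝ) :
    ∃ r, ∀ m : ℕ, ∃ v ∈ bigHoroball ι p x c, dist (f^[m] p) v ≤ r := by
  refine ⟨|c| + 1, fun m => exists_mem_bigHoroball_dist_le hM hx ?_ ?_ (by positivity)
    (by linarith [neg_le_abs c])⟩
  · refine tendsto_atTop_mono (fun i => ?_)
      (tendsto_atTop_add_const_right l (-dist p (f^[m] p)) (hesc.comp hφ))
    simpa only [Function.comp_apply, ← sub_eq_add_neg, tsub_le_iff_left] using
      dist_triangle p (f^[m] p) (f^[φ i] p)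
  · filter_upwards [hφ.eventually_ge_atTop m] with i hi
    exact (dist_iterate_le_of_le hf p hi).trans (hrecord i _ (Nat.sub_le _ _))

theorem IsSmallAtInfinity.mem_closure_image (hι : IsSmallAtInfinity ι) {y : Z} (hy : y ∉ range ι)
    {u : ℕ → M} (hu : Tendsto (fun i => ι (u i)) atTop (𝓝 y)) {S : Set M} {r : ℝ}
    (hS : ∀ i, ∃ v ∈ S, dist (u i) v ≤ r) : y ∈ closure (ι '' S) := by
  choose v hvS hv using hS
  exact mem_closure_of_tendsto (hι y hy u v r hv hu)
    (.of_forall fun i => mem_image_of_mem ι (hvS i))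

theorem notMem_range_of_tendsto_cocompact {M : Type*} [TopologicalSpace M]
    [WeaklyLocallyCompactSpace M] {ι : M → Z} (hι : IsInducing ι) {α : Type*} {l : Filter α}
    [l.NeBot] {u : α → M} (hu : Tendsto u l (cocompact M)) {y : Z}
    (hy : Tendsto (fun i => ι (u i)) l (𝓝 y)) : y ∉ range ι := by
  rintro ⟨z, rfl⟩
  exact hu.not_tendsto (disjoint_nhds_cocompact z).symm (hι.tendsto_nhds_iff.2 hy)

theorem exists_tendsto_iterate [ProperSpace M] (hM : IsLengthMetric M) [SeqCompactSpace Z]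
    (hι : IsInducing ι) (hsmall : IsSmallAtInfinity ι)
    (hsing : ∀ x ∉ range ι, (⋂ c : ℝ, closure (ι '' bigHoroball ι p x c)).Subsingleton)
    {f : M → M} (hf : LipschitzWith 1 f)
    (hesc : Tendsto (fun n : ℕ => dist p (f^[n] p)) atTop atTop) :
    ∃ y ∉ range ι, Tendsto (fun n : ℕ => ι (f^[n] p)) atTop (𝓝 y) := by
  have hcocompact : Tendsto (fun n : ℕ => f^[n] p) atTop (cocompact M) := by
    rwa [← comap_dist_left_atTop_eq_cocompact p, tendsto_comap_iff]
  have hideal : ∀ {θ : ℕ → ℕ} {y : Z}, Tendsto θ atTop atTop →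
      Tendsto (fun i => ι (f^[θ i] p)) atTop (𝓝 y) → y ∉ range ι := fun hθ hy =>
    notMem_range_of_tendsto_cocompact hι (hcocompact.comp hθ) hy
  obtain ⟨φ, hφ, hrecord⟩ := extraction_of_frequently_atTop (frequently_high_scores hesc)
  obtain ⟨x, ψ, hψ, hx⟩ := SeqCompactSpace.tendsto_subseq fun i => ι (f^[φ i] p)
  have hφψ : Tendsto (φ ∘ ψ) atTop atTop := (hφ.comp hψ).tendsto_atTop
  have hnear := exists_mem_bigHoroball_dist_iterate_le hM hf hesc hφψ
    (fun i k hk => hk.eq_or_lt.elim (fun h => h ▸ le_rfl) fun h => (hrecord (ψ i) k h).le) hx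
  have hlimit : ∀ {θ : ℕ → ℕ} {y : Z}, Tendsto θ atTop atTop →
      Tendsto (fun i => ι (f^[θ i] p)) atTop (𝓝 y) →
      y ∈ ⋂ c : ℝ, closure (ι '' bigHoroball ι p x c) := fun hθ hy => mem_iInter.2 fun c =>
    hsmall.mem_closure_image (hideal hθ hy) hy fun _ => (hnear c).choose_spec _
  refine ⟨x, hideal hφψ hx, tendsto_of_subseq_tendsto fun θ hθ => ?_⟩
  obtain ⟨y, χ, hχ, hy⟩ := SeqCompactSpace.tendsto_subseq fun i => ι (f^[θ i] p)
  obtain rfl : y = x := hsing x (hideal hφψ hx) (hlimit (hθ.comp hχ.tendsto_atTop) hy)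
    (hlimit hφψ hx)
  exact ⟨χ, hy⟩

theorem IsSmallAtInfinity.tendsto_comp_const {ι : C(M, Z)} (hι : IsSmallAtInfinity ι)
    {g : ℕ → C(M, M)} (hg : ∀ n, LipschitzWith 1 (g n)) {y : Z} (hy : y ∉ range ι)
    (h : Tendsto (fun n => ι (g n p)) atTop (𝓝 y)) :
    Tendsto (fun n => ι.comp (g n)) atTop (𝓝 (ContinuousMap.const M y)) := by
  refine ContinuousMap.tendsto_nhds_compactOpen.2 fun Q hQ U hU hQU => ?_
  by_contra hnot
  obtain ⟨θ, hθ, hθU⟩ := extraction_of_frequently_atTop (not_eventually.1 hnot)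
  have hexit : ∀ i, ∃ z ∈ Q, ι (g (θ i) z) ∉ U := fun i => by simpa [MapsTo] using hθU i
  choose z hzQ hzU using hexit
  obtain ⟨B, hB⟩ := hQ.bddAbove_image (f := dist p) (by fun_prop)
  have hbdd : ∀ i, dist (g (θ i) p) (g (θ i) (z i)) ≤ B := fun i =>
    ((hg (θ i)).dist_le_mul _ _).trans <| by
      simpa only [NNReal.coe_one, one_mul] using hB ⟨z i, hzQ i, rfl⟩
  have hlim := hι y hy _ _ B hbdd (h.comp hθ.tendsto_atTop)
  obtain ⟨i, hi⟩ := (hlim.eventually (hU.mem_nhds (hQU (hzQ 0)))).exists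
  exact hzU i hi

theorem isCompact_closure_orbit_or_tendsto_iterate [ProperSpace M] (hM : IsLengthMetric M)
    [SeqCompactSpace Z] {ι : C(M, Z)} (hι : IsInducing ι) (hsmall : IsSmallAtInfinity ι) {p : M}
    (hsing : ∀ x ∉ range ι, (⋂ c : ℝ, closure (ι '' bigHoroball ι p x c)).Subsingleton)
    {f : M → M} (hf : LipschitzWith 1 f) :
    (∀ z, IsCompact (closure (range fun n : ℕ => f^[n] z))) ∨
      ∃ y ∉ range ι, Tendsto (fun n : ℕ => ι.comp ⟨f^[n], hf.continuous.iterate n⟩) atTop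
        (𝓝 (ContinuousMap.const M y)) := by
  refine (isBounded_range_iterate_or_tendsto_dist_iterate hf p).imp
    (fun hbdd z => (hbdd z).isCompact_closure) fun hesc => ?_
  obtain ⟨y, hy, hlim⟩ := exists_tendsto_iterate hM hι hsmall hsing hf hesc
  refine ⟨y, hy, hsmall.tendsto_comp_const (fun n => ?_) hy hlim⟩
  simpa only [one_pow, ContinuousMap.coe_mk] using hf.iterate n

end Horoballs

/-! ### Chains of holomorphic discs -/

section PoincareDistance

theorem artanh_sub_artanh {s t : ℝ} (hs : 0 ≤ s) (hst : s ≤ t) (ht : t < 1) :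
    Real.artanh t - Real.artanh s = Real.artanh ((t - s) / (1 - s * t)) := by
  have hpos : 0 < 1 - s * t := by nlinarith
  have hx0 : 0 ≤ (t - s) / (1 - s * t) := div_nonneg (by linarith) hpos.le
  have hx1 : (t - s) / (1 - s * t) < 1 := (div_lt_one hpos).2 (by nlinarith)
  rw [Real.artanh_eq_half_log ⟨by linarith, hx1.le⟩,
    Real.artanh_eq_half_log ⟨by linarith, ht.le⟩,
    Real.artanh_eq_half_log ⟨by linarith, by linarith⟩, ← mul_sub,
    ← Real.log_div (div_pos (by linarith) (by linarith)).ne'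
      (div_pos (by linarith) (by linarith)).ne']
  congr 2
  have hnum : 1 + (t - s) / (1 - s * t) = (1 + t) * (1 - s) / (1 - s * t) := by
    rw [eq_div_iff hpos.ne', add_mul, div_mul_cancel₀ _ hpos.ne']
    ring
  have hden : 1 - (t - s) / (1 - s * t) = (1 - t) * (1 + s) / (1 - s * t) := by
    rw [eq_div_iff hpos.ne', sub_mul, div_mul_cancel₀ _ hpos.ne']
    ring
  rw [hnum, hden, div_div_div_cancel_right₀ hpos.ne', div_div_div_eq]

theorem exists_artanh_eq {r : ℝ} (hr : 0 ≤ r) : ∃ t, 0 ≤ t ∧ t < 1 ∧ Real.artanh t = r := by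
  refine ⟨Real.tanh r, ?_, Real.tanh_lt_one r, Real.artanh_tanh r⟩
  rw [Real.tanh_eq_sinh_div_cosh]
  exact div_nonneg (Real.sinh_nonneg_iff.2 hr) (Real.cosh_pos r).le

theorem one_add_conj_mul_ne_zero {a b : ℂ} (ha : ‖a‖ < 1) (hb : ‖b‖ < 1) :
    1 + conj a * b ≠ 0 := by
  intro h
  have : ‖conj a * b‖ < 1 := by
    rw [norm_mul, RCLike.norm_conj]
    exact mul_lt_one_of_nonneg_of_lt_one_left (norm_nonneg a) ha hb.le
  rw [eq_neg_of_add_eq_zero_right h, norm_neg, norm_one] at this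
  exact this.false

theorem normSq_one_add_conj_mul_sub_normSq_add (a b : ℂ) :
    Complex.normSq (1 + conj a * b) - Complex.normSq (a + b) =
      (1 - Complex.normSq a) * (1 - Complex.normSq b) := by
  simp only [Complex.normSq_apply, Complex.add_re, Complex.add_im, Complex.one_re, Complex.one_im,
    Complex.mul_re, Complex.mul_im, Complex.conj_re, Complex.conj_im]
  ring

theorem norm_mobius_lt_one {a b : ℂ} (ha : ‖a‖ < 1) (hb : ‖b‖ < 1) :
    ‖(a + b) / (1 + conj a * b)‖ < 1 := by
  have hsq : ∀ {c : ℂ}, ‖c‖ < 1 → 0 < 1 - Complex.normSq c := fun {c} hc => by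
    rw [Complex.normSq_eq_norm_sq, sub_pos]
    exact pow_lt_one₀ (norm_nonneg c) hc two_ne_zero
  rw [norm_div, div_lt_one (norm_pos_iff.2 (one_add_conj_mul_ne_zero ha hb))]
  refine lt_of_pow_lt_pow_left₀ 2 (norm_nonneg _) (sub_pos.1 ?_)
  rw [← Complex.normSq_eq_norm_sq, ← Complex.normSq_eq_norm_sq,
    normSq_one_add_conj_mul_sub_normSq_add]
  exact mul_pos (hsq ha) (hsq hb)

theorem poincareDist_nonneg (ζ η : ℂ) : 0 ≤ poincareDist ζ η :=
  Real.artanh_nonneg (norm_nonneg _)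

theorem poincareDist_comm (ζ η : ℂ) : poincareDist ζ η = poincareDist η ζ := by
  have hden : ‖1 - conj ζ * η‖ = ‖1 - conj η * ζ‖ := by
    rw [← RCLike.norm_conj]
    simp only [map_sub, map_one, map_mul, Complex.conj_conj, mul_comm]
  rw [poincareDist, poincareDist, norm_div, norm_div, norm_sub_rev, hden]

theorem poincareDist_ofReal {s t : ℝ} (hs : 0 ≤ s) (hst : s ≤ t) (ht : t < 1) :
    poincareDist s t = Real.artanh t - Real.artanh s := by
  have hpos : 0 < 1 - s * t := by nlinarith
  rw [artanh_sub_artanh hs hst ht, poincareDist, Complex.conj_ofReal, norm_div, norm_sub_rev]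
  norm_cast
  rw [Real.norm_of_nonneg (sub_nonneg.2 hst), Real.norm_of_nonneg hpos.le]

end PoincareDistance

section DiscChains

variable {E : Type*} [NormedAddCommGroup E] [NormedSpace ℂ E]
  {M : Type*} [TopologicalSpace M] [ChartedSpace E M]

theorem mdifferentiableOn_comp_mobius {φ : ℂ → M}
    (hφ : MDifferentiableOn 𝓘(ℂ) 𝓘(ℂ, E) φ (Metric.ball 0 1)) {a u : ℂ} (ha : ‖a‖ < 1)
    (hu : ‖u‖ = 1) :
    MDifferentiableOn 𝓘(ℂ) 𝓘(ℂ, E) (fun ξ => φ ((a + u * ξ) / (1 + conj a * (u * ξ))))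
      (Metric.ball 0 1) := by
  have hrot : ∀ ξ ∈ Metric.ball (0 : ℂ) 1, ‖u * ξ‖ < 1 := fun ξ hξ => by
    rwa [norm_mul, hu, one_mul, ← mem_ball_zero_iff]
  refine hφ.comp (f := fun ξ : ℂ => (a + u * ξ) / (1 + conj a * (u * ξ))) ?_
    fun ξ hξ => mem_ball_zero_iff.2 (norm_mobius_lt_one ha (hrot ξ hξ))
  rw [mdifferentiableOn_iff_differentiableOn]
  exact DifferentiableOn.div (by fun_prop) (by fun_prop)
    fun ξ hξ => one_add_conj_mul_ne_zero ha (hrot ξ hξ)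

theorem exists_normalized_disc {φ : ℂ → M}
    (hφ : MDifferentiableOn 𝓘(ℂ) 𝓘(ℂ, E) φ (Metric.ball 0 1)) {ζ η : ℂ}
    (hζ : ζ ∈ Metric.ball (0 : ℂ) 1) (hη : η ∈ Metric.ball (0 : ℂ) 1) :
    ∃ ψ : ℂ → M, MDifferentiableOn 𝓘(ℂ) 𝓘(ℂ, E) ψ (Metric.ball 0 1) ∧
      ∃ t : ℝ, 0 ≤ t ∧ t < 1 ∧ ψ 0 = φ ζ ∧ ψ t = φ η ∧ poincareDist ζ η = Real.artanh t := by
  rw [mem_ball_zero_iff] at hζ hη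
  have hζ' : ‖-ζ‖ < 1 := by rwa [norm_neg]
  have hconj : 1 + conj (-ζ) * η = 1 - conj ζ * η := by rw [map_neg]; ring
  set c : ℂ := (η - ζ) / (1 - conj ζ * η) with hc
  have hne : 1 - conj ζ * η ≠ 0 := hconj ▸ one_add_conj_mul_ne_zero hζ' hη
  have hc1 : ‖c‖ < 1 := by
    simpa only [hconj, neg_add_eq_sub, ← hc] using norm_mobius_lt_one hζ' hη
  obtain ⟨u, hu, hcu⟩ : ∃ u : ℂ, ‖u‖ = 1 ∧ u * ‖c‖ = c :=
    ⟨Complex.exp (c.arg * Complex.I), Complex.norm_exp_ofReal_mul_I _, by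
      rw [mul_comm, Complex.norm_mul_exp_arg_mul_I]⟩
  refine ⟨_, mdifferentiableOn_comp_mobius hφ hζ hu, ‖c‖, norm_nonneg _, hc1, by simp, ?_, ?_⟩
  · have hcη : c * (1 - conj ζ * η) = η - ζ := div_mul_cancel₀ _ hne
    simp only [hcu]
    rw [(div_eq_iff (one_add_conj_mul_ne_zero hζ hc1)).2]
    linear_combination hcη
  · rw [poincareDist, hc, norm_div, norm_div, norm_sub_rev]

theorem DiscChain.single {φ : ℂ → M}
    (hφ : MDifferentiableOn 𝓘(ℂ) 𝓘(ℂ, E) φ (Metric.ball 0 1)) {s t : ℝ} (hs : 0 ≤ s)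
    (hst : s ≤ t) (ht : t < 1) :
    DiscChain E (φ s) (φ t) (Real.artanh t - Real.artanh s) := by
  have hball : ∀ r : ℝ, 0 ≤ r → r < 1 → (r : ℂ) ∈ Metric.ball (0 : ℂ) 1 := fun r hr hr1 => by
    rwa [mem_ball_zero_iff, Complex.norm_of_nonneg hr]
  simpa only [add_zero, poincareDist_ofReal hs hst ht] using
    DiscChain.cons φ hφ s t (hball s hs (hst.trans_lt ht)) (hball t (hs.trans hst) ht) (φ t) 0
      (.nil _)

theorem DiscChain.single_zero {φ : ℂ → M}
    (hφ : MDifferentiableOn 𝓘(ℂ) 𝓘(ℂ, E) φ (Metric.ball 0 1)) {t : ℝ} (ht0 : 0 ≤ t)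
    (ht1 : t < 1) : DiscChain E (φ 0) (φ t) (Real.artanh t) := by
  simpa only [Complex.ofReal_zero, Real.artanh_zero, sub_zero] using
    DiscChain.single hφ le_rfl ht0 ht1

theorem DiscChain.trans {x y z : M} {L L' : ℝ} (h : DiscChain E x y L) (h' : DiscChain E y z L') :
    DiscChain E x z (L + L') := by
  induction h with
  | nil => rwa [zero_add]
  | cons φ hφ ζ η hζ hη w L _ ih =>
    rw [add_assoc]
    exact .cons φ hφ ζ η hζ hη _ _ (ih h')

theorem DiscChain.symm {x y : M} {L : ℝ} (h : DiscChain E x y L) : DiscChain E y x L := by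
  induction h with
  | nil => exact .nil _
  | cons φ hφ ζ η hζ hη w L _ ih =>
    have hback : DiscChain E (φ η) (φ ζ) (poincareDist ζ η) := by
      simpa only [add_zero, poincareDist_comm η] using DiscChain.cons φ hφ η ζ hη hζ _ 0 (.nil _)
    rw [add_comm]
    exact ih.trans hback

theorem DiscChain.nonneg {x y : M} {L : ℝ} (h : DiscChain E x y L) : 0 ≤ L := by
  induction h with
  | nil => exact le_rfl
  | cons _ _ _ _ _ _ _ _ _ ih => exact add_nonneg (poincareDist_nonneg _ _) ih

theorem DiscChain.map {F : Type*} [NormedAddCommGroup F] [NormedSpace ℂ F]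
    {N : Type*} [TopologicalSpace N] [ChartedSpace F N] {f : M → N}
    (hf : MDifferentiable 𝓘(ℂ, E) 𝓘(ℂ, F) f) {x y : M} {L : ℝ} (h : DiscChain E x y L) :
    DiscChain F (f x) (f y) L := by
  induction h with
  | nil => exact .nil _
  | cons φ hφ ζ η hζ hη w L _ ih =>
    exact .cons (f ∘ φ) (hf.comp_mdifferentiableOn hφ) ζ η hζ hη _ _ ih

theorem DiscChain.split {x y : M} {L : ℝ} (h : DiscChain E x y L) {r : ℝ} (hr : 0 ≤ r)
    (hrL : r ≤ L) : ∃ v, DiscChain E x v r ∧ DiscChain E v y (L - r) := by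
  induction h generalizing r with
  | nil z =>
    obtain rfl : r = 0 := le_antisymm hrL hr
    exact ⟨z, .nil z, by rw [sub_zero]; exact .nil z⟩
  | cons φ hφ ζ η hζ hη w L h ih =>
    obtain ⟨ψ, hψ, t, ht0, ht1, hψ0, hψt, hdist⟩ := exists_normalized_disc hφ hζ hη
    rw [← hψ0]
    rw [← hψt] at h ih
    rw [hdist] at hrL ⊢
    rcases le_total r (Real.artanh t) with hrt | hrt
    · obtain ⟨s, hs0, hs1, rfl⟩ := exists_artanh_eq hr
      have hst : s ≤ t :=
        (Real.artanh_le_artanh_iff ⟨by linarith, hs1⟩ ⟨by linarith, ht1⟩).1 hrt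
      refine ⟨ψ s, .single_zero hψ hs0 hs1, ?_⟩
      rw [add_sub_right_comm]
      exact (DiscChain.single hψ hs0 hst ht1).trans h
    · obtain ⟨v, hv, hv'⟩ := ih (r := r - Real.artanh t) (by linarith) (by linarith)
      refine ⟨v, ?_, ?_⟩
      · simpa only [add_sub_cancel] using (DiscChain.single_zero hψ ht0 ht1).trans hv
      · rwa [add_comm, ← sub_sub_eq_add_sub]

theorem DiscChain.exists_isPreconnected {x y : M} {L : ℝ} (h : DiscChain E x y L) :
    ∃ C : Set M, IsPreconnected C ∧ x ∈ C ∧ y ∈ C ∧ ∀ v ∈ C, ∃ L' ≤ L, DiscChain E x v L' := by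
  induction h with
  | nil z =>
    refine ⟨{z}, isPreconnected_singleton, rfl, rfl, ?_⟩
    rintro _ rfl
    exact ⟨0, le_rfl, .nil _⟩
  | cons φ hφ ζ η hζ hη w L h ih =>
    obtain ⟨ψ, hψ, t, ht0, ht1, hψ0, hψt, hdist⟩ := exists_normalized_disc hφ hζ hη
    obtain ⟨C, hC, hηC, hwC, hCL⟩ := ih
    rw [← hψ0, hdist]
    rw [← hψt] at hηC hCL
    have hcont : ContinuousOn (fun s : ℝ => ψ s) (Icc 0 t) :=
      hψ.continuousOn.comp Complex.continuous_ofReal.continuousOn fun s hs => by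
        rw [mem_ball_zero_iff, Complex.norm_of_nonneg hs.1]
        exact hs.2.trans_lt ht1
    refine ⟨(fun s : ℝ => ψ s) '' Icc 0 t ∪ C,
      .union (ψ t) ⟨t, right_mem_Icc.2 ht0, rfl⟩ hηC (isPreconnected_Icc.image _ hcont) hC,
      .inl ⟨0, left_mem_Icc.2 ht0, congrArg ψ Complex.ofReal_zero⟩, .inr hwC, ?_⟩
    rintro v (⟨s, hs, rfl⟩ | hv)
    · refine ⟨Real.artanh s, ?_, .single_zero hψ hs.1 (hs.2.trans_lt ht1)⟩
      linarith [Real.artanh_le_artanh (by linarith [hs.1]) ht1 hs.2, h.nonneg]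
    · obtain ⟨L', hL', hv⟩ := hCL v hv
      exact ⟨Real.artanh t + L', by gcongr, (DiscChain.single_zero hψ ht0 ht1).trans hv⟩

theorem DiscChain.eventually_short [IsManifold 𝓘(ℂ, E) 1 M] (x : M) {ε : ℝ} (hε : 0 < ε) :
    ∀ᶠ y in 𝓝 x, ∃ L < ε, DiscChain E x y L := by
  obtain ⟨ρ, hρ, hball⟩ := Metric.isOpen_iff.1 (chartAt E x).open_target _ (mem_chart_target E x)
  obtain ⟨t, ht0, ht1, hta⟩ := exists_artanh_eq (half_pos hε).le
  replace ht0 : 0 < t := ht0.lt_of_ne <| by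
    rintro rfl
    rw [Real.artanh_zero] at hta
    exact (half_pos hε).ne hta
  have htc : (t : ℂ) ≠ 0 := Complex.ofReal_ne_zero.2 ht0.ne'
  have hnear : ∀ᶠ y in 𝓝 x, chartAt E x y ∈ Metric.ball (chartAt E x x) (t * ρ) :=
    ((chartAt E x).continuousAt (mem_chart_source E x)).eventually
      (Metric.ball_mem_nhds _ (mul_pos ht0 hρ))
  filter_upwards [hnear, (chartAt E x).open_source.mem_nhds (mem_chart_source E x)] with y hy hys
  set v : E := (t : ℂ)⁻¹ • (chartAt E x y - chartAt E x x) with hv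
  have hvρ : ‖v‖ < ρ := by
    rwa [norm_smul, norm_inv, Complex.norm_of_nonneg ht0.le, ← dist_eq_norm,
      inv_mul_lt_iff₀ ht0]
  -- the affine disc in the chart through the two points
  have hψ : MDifferentiableOn 𝓘(ℂ) 𝓘(ℂ, E)
      (fun ξ : ℂ => (chartAt E x).symm (chartAt E x x + ξ • v)) (Metric.ball 0 1) := by
    refine (mdifferentiableOn_atlas_symm (I := 𝓘(ℂ, E)) (chart_mem_atlas E x)).comp
      (f := fun ξ : ℂ => chartAt E x x + ξ • v) ?_ fun ξ hξ => hball ?_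
    · rw [mdifferentiableOn_iff_differentiableOn]
      fun_prop
    · rw [mem_ball_iff_norm, add_sub_cancel_left, norm_smul]
      exact (mul_le_of_le_one_left (norm_nonneg v) (mem_ball_zero_iff.1 hξ).le).trans_lt hvρ
  refine ⟨ε / 2, half_lt_self hε, ?_⟩
  simpa only [zero_smul, add_zero, hv, smul_inv_smul₀ htc, add_sub_cancel, hta,
    (chartAt E x).left_inv hys, (chartAt E x).left_inv (mem_chart_source E x)] using
    DiscChain.single_zero hψ ht0.le ht1

end DiscChains

/-! ### Hyperbolic manifolds as length metric spaces -/

theorem exists_mem_frontier_of_isPreconnected {Y : Type*} [TopologicalSpace Y] {C N : Set Y}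
    (hC : IsPreconnected C) (hN : (C ∩ N).Nonempty) (hN' : (C ∩ Nᶜ).Nonempty) :
    (C ∩ frontier N).Nonempty := by
  by_contra! h
  have hsub : C ⊆ interior N ∪ interior Nᶜ := fun c hc => by
    by_contra hc'
    rw [mem_union, not_or, interior_compl, notMem_compl_iff] at hc'
    exact h.subset ⟨hc, hc'.2, hc'.1⟩
  obtain ⟨c, -, hc, hc'⟩ := hC _ _ isOpen_interior isOpen_interior hsub
    (hN.mono fun c hc => ⟨hc.1, (hsub hc.1).resolve_right fun h => interior_subset h hc.2⟩)
    (hN'.mono fun c hc => ⟨hc.1, (hsub hc.1).resolve_left fun h => hc.2 (interior_subset h)⟩)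
  exact interior_subset hc' (interior_subset hc)

section KobayashiDist

variable (E : Type*) [NormedAddCommGroup E] [NormedSpace ℂ E]
  {M : Type*} [TopologicalSpace M] [ChartedSpace E M]

variable {E} in
theorem kobayashiDist_le {z w : M} {L : ℝ} (h : DiscChain E z w L) : kobayashiDist E z w ≤ L :=
  csInf_le ⟨0, fun _ h => h.nonneg⟩ h

theorem kobayashiDist_nonneg (z w : M) : 0 ≤ kobayashiDist E z w :=
  Real.sInf_nonneg fun _ h => DiscChain.nonneg h

theorem kobayashiDist_self (z : M) : kobayashiDist E z z = 0 :=
  (kobayashiDist_le (.nil z)).antisymm (kobayashiDist_nonneg E z z)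

theorem kobayashiDist_comm (z w : M) : kobayashiDist E z w = kobayashiDist E w z :=
  congrArg sInf (Set.ext fun _ => ⟨DiscChain.symm, DiscChain.symm⟩)

variable [IsManifold 𝓘(ℂ, E) 1 M]

theorem eventually_kobayashiDist_lt (z : M) {ε : ℝ} (hε : 0 < ε) :
    ∀ᶠ w in 𝓝 z, kobayashiDist E z w < ε :=
  (DiscChain.eventually_short z hε).mono fun _ ⟨_, hL, h⟩ => (kobayashiDist_le h).trans_lt hL

variable [PreconnectedSpace M]

theorem exists_discChain (z w : M) : ∃ L, DiscChain E z w L := by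
  have hclopen : IsClopen {w : M | ∃ L, DiscChain E z w L} := by
    refine ⟨⟨isOpen_iff_mem_nhds.2 fun w hw => ?_⟩, isOpen_iff_mem_nhds.2 fun w ⟨L, hL⟩ => ?_⟩
    · filter_upwards [DiscChain.eventually_short (E := E) w one_pos]
      rintro u ⟨L, -, hL⟩ ⟨L', hL'⟩
      exact hw ⟨_, hL'.trans hL.symm⟩
    · filter_upwards [DiscChain.eventually_short (E := E) w one_pos]
      rintro u ⟨L', -, hL'⟩
      exact ⟨_, hL.trans hL'⟩
  exact (hclopen.eq_univ ⟨z, 0, .nil z⟩).ge (mem_univ w)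

variable {E} in
theorem exists_discChain_lt {z w : M} {c : ℝ} (h : kobayashiDist E z w < c) :
    ∃ L < c, DiscChain E z w L := by
  obtain ⟨L, hL, hLc⟩ := exists_lt_of_csInf_lt (exists_discChain E z w) h
  exact ⟨L, hLc, hL⟩

theorem kobayashiDist_triangle (x y z : M) :
    kobayashiDist E x z ≤ kobayashiDist E x y + kobayashiDist E y z := by
  refine le_of_forall_pos_lt_add fun ε hε => ?_
  obtain ⟨L, hL, h⟩ := exists_discChain_lt (lt_add_of_pos_right (kobayashiDist E x y) (half_pos hε))
  obtain ⟨L', hL', h'⟩ :=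
    exists_discChain_lt (lt_add_of_pos_right (kobayashiDist E y z) (half_pos hε))
  linarith [kobayashiDist_le (h.trans h')]

variable {E} in
theorem kobayashiDist_map_le {F : Type*} [NormedAddCommGroup F] [NormedSpace ℂ F]
    {N : Type*} [TopologicalSpace N] [ChartedSpace F N] {f : M → N}
    (hf : MDifferentiable 𝓘(ℂ, E) 𝓘(ℂ, F) f) (z w : M) :
    kobayashiDist F (f z) (f w) ≤ kobayashiDist E z w :=
  le_csInf (exists_discChain E z w) fun _ h => kobayashiDist_le (h.map hf)

theorem exists_kobayashiDist_le_and_lt (z w : M) {r ε : ℝ} (hr : 0 ≤ r)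
    (hrk : r ≤ kobayashiDist E z w) (hε : 0 < ε) :
    ∃ v, kobayashiDist E z v ≤ r ∧ kobayashiDist E v w < kobayashiDist E z w - r + ε := by
  obtain ⟨L, hL, h⟩ := exists_discChain_lt (lt_add_of_pos_right (kobayashiDist E z w) hε)
  obtain ⟨v, hzv, hvw⟩ := h.split hr (hrk.trans (kobayashiDist_le h))
  exact ⟨v, kobayashiDist_le hzv, (kobayashiDist_le hvw).trans_lt (by linarith)⟩

variable {E} in
theorem exists_isPreconnected_of_kobayashiDist_lt {z w : M} {c : ℝ} (h : kobayashiDist E z w < c) :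
    ∃ C : Set M, IsPreconnected C ∧ z ∈ C ∧ w ∈ C ∧ ∀ v ∈ C, kobayashiDist E z v < c := by
  obtain ⟨L, hL, h⟩ := exists_discChain_lt h
  obtain ⟨C, hC, hz, hw, hCL⟩ := h.exists_isPreconnected
  refine ⟨C, hC, hz, hw, fun v hv => ?_⟩
  obtain ⟨L', hL', h'⟩ := hCL v hv
  exact (kobayashiDist_le h').trans_lt (hL'.trans_lt hL)

theorem continuous_kobayashiDist_right (z : M) : Continuous (kobayashiDist E z : M → ℝ) := by
  refine continuous_iff_continuousAt.2 fun w => Metric.tendsto_nhds.2 fun ε hε => ?_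
  filter_upwards [eventually_kobayashiDist_lt E w hε] with u hu
  have hzu := kobayashiDist_triangle E z w u
  have hzw := kobayashiDist_triangle E z u w
  rw [kobayashiDist_comm E u w] at hzw
  rw [Real.dist_eq, abs_sub_lt_iff]
  constructor <;> linarith

variable {E}

theorem KobayashiHyperbolic.exists_le_kobayashiDist (hM : KobayashiHyperbolic E M) {x : M}
    {Q : Set M} (hQ : IsCompact Q) (hx : x ∉ Q) : ∃ δ > 0, ∀ y ∈ Q, δ ≤ kobayashiDist E x y := by
  rcases Q.eq_empty_or_nonempty with rfl | hQ'
  · exact ⟨1, one_pos, fun _ h => h.elim⟩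
  obtain ⟨c, hc, hmin⟩ := hQ.exists_isMinOn hQ' (continuous_kobayashiDist_right E x).continuousOn
  refine ⟨_, (kobayashiDist_nonneg E x c).lt_of_ne fun h => hx ?_, fun y hy => hmin hy⟩
  rwa [hM x c h.symm]

variable [T2Space M] [LocallyCompactSpace M]

/-- Barth's theorem: the topology of a hyperbolic manifold is the Kobayashi metric topology. A chain
of discs leaving a compact neighbourhood of `x` crosses its frontier, which has positive distance
from `x`. -/
theorem KobayashiHyperbolic.isOpen_iff (hM : KobayashiHyperbolic E M) (s : Set M) :
    IsOpen s ↔ ∀ x ∈ s, ∃ ε > 0, ∀ y, kobayashiDist E x y < ε → y ∈ s := by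
  refine ⟨fun hs x hx => ?_, fun h => isOpen_iff_mem_nhds.2 fun x hx => ?_⟩
  · obtain ⟨N, hN, hxN, hNs⟩ := exists_compact_subset hs hx
    have hfrontier : IsCompact (frontier N) :=
      hN.of_isClosed_subset isClosed_frontier hN.isClosed.frontier_subset
    obtain ⟨δ, hδ, hδN⟩ := hM.exists_le_kobayashiDist hfrontier fun h => h.2 hxN
    refine ⟨δ, hδ, fun y hy => hNs ?_⟩
    by_contra hyN
    obtain ⟨C, hC, hxC, hyC, hCδ⟩ := exists_isPreconnected_of_kobayashiDist_lt hy
    obtain ⟨c, hcC, hcN⟩ := exists_mem_frontier_of_isPreconnected hC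
      ⟨x, hxC, interior_subset hxN⟩ ⟨y, hyC, hyN⟩
    exact (hCδ c hcC).not_ge (hδN c hcN)
  · obtain ⟨ε, hε, hs⟩ := h x hx
    exact (eventually_kobayashiDist_lt E x hε).mono hs

/-- The Kobayashi distance of a hyperbolic manifold as a metric. By Barth's theorem its topology can
be chosen definitionally equal to the manifold topology. -/
noncomputable abbrev KobayashiHyperbolic.metricSpace (hM : KobayashiHyperbolic E M) :
    MetricSpace M :=
  .ofDistTopology (kobayashiDist E) (kobayashiDist_self E) (kobayashiDist_comm E)
    (kobayashiDist_triangle E) hM.isOpen_iff hM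

theorem KobayashiHyperbolic.isLengthMetric (hM : KobayashiHyperbolic E M) :
    letI := hM.metricSpace; IsLengthMetric M :=
  fun z w _ hr hrk _ hε => exists_kobayashiDist_le_and_lt E z w hr hrk hε

theorem KobayashiHyperbolic.lipschitzWith_one (hM : KobayashiHyperbolic E M) {f : M → M}
    (hf : ∀ z w, kobayashiDist E (f z) (f w) ≤ kobayashiDist E z w) :
    letI := hM.metricSpace; LipschitzWith 1 f :=
  letI := hM.metricSpace
  LipschitzWith.mk_one hf

theorem KobayashiHyperbolic.continuous_of_kobayashiDist_map_le (hM : KobayashiHyperbolic E M)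
    {f : M → M} (hf : ∀ z w, kobayashiDist E (f z) (f w) ≤ kobayashiDist E z w) : Continuous f :=
  letI := hM.metricSpace
  (hM.lipschitzWith_one hf).continuous

theorem KobayashiComplete.properSpace (hM : KobayashiHyperbolic E M) (hc : KobayashiComplete E M) :
    letI := hM.metricSpace; ProperSpace M := by
  let := hM.metricSpace
  have : CompleteSpace M := UniformSpace.complete_of_cauchySeq_tendsto fun u hu => by
    obtain ⟨z, hz⟩ := hc u fun ε hε => Metric.cauchySeq_iff.1 hu ε hε
    exact ⟨z, tendsto_iff_dist_tendsto_zero.2 hz⟩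
  exact IsLengthMetric.properSpace hM.isLengthMetric

end KobayashiDist

/-! ### Convergence in the end compactification -/

theorem tendsto_cocompact_of_notMem_range {M Z : Type*} [TopologicalSpace M] [TopologicalSpace Z]
    {ι : M → Z} (hι : ∀ Q, IsCompact Q → IsClosed (ι '' Q)) {y : Z} (hy : y ∉ range ι)
    {α : Type*} {l : Filter α} {v : α → M} (hv : Tendsto (fun i => ι (v i)) l (𝓝 y)) :
    Tendsto v l (cocompact M) := by
  refine hasBasis_cocompact.tendsto_right_iff.2 fun Q hQ => ?_
  filter_upwards [hv ((hι Q hQ).isOpen_compl.mem_nhds fun h => hy (image_subset_range ι Q h))]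
    with i hi hiQ using hi (mem_image_of_mem ι hiQ)

theorem isClosed_of_subset_range_of_tendsto_cocompact {Y : Type*} [TopologicalSpace Y] [T2Space Y]
    [WeaklyLocallyCompactSpace Y] {v : ℕ → Y} (hv : Tendsto v atTop (cocompact Y)) {S : Set Y}
    (hS : S ⊆ range v) : IsClosed S := by
  have hproper : IsProperMap v := isProperMap_iff_tendsto_cocompact.2
    ⟨continuous_of_discreteTopology, by rwa [cocompact_eq_cofinite, Nat.cofinite_eq_atTop]⟩
  rw [← image_preimage_eq_of_subset hS]
  exact hproper.isClosedMap _ (isClosed_discrete _)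

theorem eventually_subset_of_inter_nonempty {Y : Type*} [TopologicalSpace Y] [T2Space Y]
    {α : Type*} {l : Filter α} {D : α → Set Y} (hD : ∀ i, IsPreconnected (D i))
    (hcross : ∀ A A' : Set Y, IsCompact A → IsCompact A' → Disjoint A A' →
      ∀ᶠ i in l, Disjoint (D i) A ∨ Disjoint (D i) A')
    {N N' : Set Y} (hN : IsCompact N) (hN' : IsCompact N') (hNN' : N ⊆ interior N') :
    ∀ᶠ i in l, (D i ∩ N).Nonempty → D i ⊆ N' := by
  have hdisj : Disjoint (frontier N) (frontier N') :=
    disjoint_interior_frontier.mono_left (hN.isClosed.frontier_subset.trans hNN')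
  filter_upwards [hcross _ _ (hN.of_isClosed_subset isClosed_frontier hN.isClosed.frontier_subset)
    (hN'.of_isClosed_subset isClosed_frontier hN'.isClosed.frontier_subset) hdisj] with i hi hDN
  by_contra hDN'
  have hsub : N ⊆ N' := hNN'.trans interior_subset
  have hout : (D i ∩ N'ᶜ).Nonempty := inter_compl_nonempty_iff.2 hDN'
  have hmeets : (D i ∩ frontier N).Nonempty := exists_mem_frontier_of_isPreconnected (hD i) hDN
    (hout.mono (inter_subset_inter_right _ (compl_subset_compl.2 hsub)))
  have hmeets' : (D i ∩ frontier N').Nonempty := exists_mem_frontier_of_isPreconnected (hD i)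
    (hDN.mono (inter_subset_inter_right _ hsub)) hout
  exact hi.elim (not_disjoint_iff_nonempty_inter.2 hmeets)
    (not_disjoint_iff_nonempty_inter.2 hmeets')

namespace SpaceEnd

variable {Y : Type*} [TopologicalSpace Y] {K : CompactExhaustion Y}

theorem disjoint_comp (e : SpaceEnd K) (j : ℕ) : Disjoint (e.comp j) (K j) := by
  obtain ⟨y, -, he⟩ := e.isComponent j
  rw [he]
  exact disjoint_left.2 fun z hz => connectedComponentIn_subset _ _ hz

theorem subset_comp_of_mem (e : SpaceEnd K) {j : ℕ} {D : Set Y}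
    (hD : IsPreconnected D) (hDK : Disjoint D (K j)) {y : Y} (hy : y ∈ D) (hye : y ∈ e.comp j) :
    D ⊆ e.comp j := by
  obtain ⟨y₀, -, he⟩ := e.isComponent j
  rw [he] at hye ⊢
  rw [connectedComponentIn_eq hye]
  exact hD.subset_connectedComponentIn hy hDK.subset_compl_right

end SpaceEnd

namespace EndCompactification

variable {Y : Type*} [TopologicalSpace Y] {K : CompactExhaustion Y}

theorem ofPoint_injective : Function.Injective (ofPoint : Y → EndCompactification K) :=
  fun _ _ h => by injection h

theorem ofEnd_notMem_range_ofPoint (e : SpaceEnd K) : ofEnd e ∉ range (ofPoint (K := K)) := by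
  rintro ⟨y, hy⟩
  cases hy

theorem isOpen_image_ofPoint {V : Set Y} (hV : IsOpen V) :
    IsOpen (ofPoint '' V : Set (EndCompactification K)) :=
  ⟨by rwa [preimage_image_eq _ ofPoint_injective],
    fun e he => (ofEnd_notMem_range_ofPoint e (image_subset_range _ _ he)).elim⟩

theorem isOpenEmbedding_ofPoint : IsOpenEmbedding (ofPoint : Y → EndCompactification K) :=
  .of_continuous_injective_isOpenMap (continuous_ofPoint K) ofPoint_injective
    fun _ => isOpen_image_ofPoint

theorem isOpen_image_compl_union (e : SpaceEnd K) {j : ℕ} {S : Set Y} (hS : IsClosed S)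
    (hSe : Disjoint (e.comp j) S) :
    IsOpen (ofPoint '' Sᶜ ∪ ofEnd '' {g | ∀ i ≤ j, g.comp i = e.comp i} :
      Set (EndCompactification K)) := by
  refine ⟨?_, fun g hg => ⟨j, ?_⟩⟩
  · convert hS.isOpen_compl using 1
    ext y
    simp
  · have hg : ∀ i ≤ j, g.comp i = e.comp i := by simpa using hg
    refine union_subset_union (image_mono ?_) (image_mono fun g' hg' i hi => ?_)
    · rw [hg j le_rfl]
      exact hSe.subset_compl_right
    · exact (hg' i hi).trans (hg i hi)

variable [T2Space Y]

theorem isClosed_image_ofPoint {Q : Set Y} (hQ : IsCompact Q) :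
    IsClosed (ofPoint '' Q : Set (EndCompactification K)) := by
  rw [← isOpen_compl_iff]
  refine ⟨?_, fun e _ => ?_⟩
  · rw [preimage_compl, preimage_image_eq _ ofPoint_injective]
    exact hQ.isClosed.isOpen_compl
  obtain ⟨j, hj⟩ := K.exists_superset_of_isCompact hQ
  refine ⟨j, ?_⟩
  rintro _ (⟨y, hy, rfl⟩ | ⟨g, -, rfl⟩) hQ'
  · rw [ofPoint_injective.mem_set_image] at hQ'
    exact disjoint_left.1 (e.disjoint_comp j) hy (hj hQ')
  · exact ofEnd_notMem_range_ofPoint g (image_subset_range _ _ hQ')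

theorem tendsto_cocompact_of_tendsto_ofEnd {v : ℕ → Y} {e : SpaceEnd K}
    (hv : Tendsto (fun i => ofPoint (v i)) atTop (𝓝 (ofEnd e))) :
    Tendsto v atTop (cocompact Y) :=
  tendsto_cocompact_of_notMem_range (fun _ => isClosed_image_ofPoint)
    (ofEnd_notMem_range_ofPoint e) hv

variable [WeaklyLocallyCompactSpace Y]

/-- The components of an end need not be open, but they absorb every sequence converging to the
end: the terms outside a component form a closed set, whose complement is a neighbourhood. -/
theorem eventually_mem_comp_of_tendsto_ofEnd {v : ℕ → Y} {e : SpaceEnd K}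
    (hv : Tendsto (fun i => ofPoint (v i)) atTop (𝓝 (ofEnd e))) (j : ℕ) :
    ∀ᶠ i in atTop, v i ∈ e.comp j := by
  have hclosed : IsClosed (range v \ e.comp j) :=
    isClosed_of_subset_range_of_tendsto_cocompact (tendsto_cocompact_of_tendsto_ofEnd hv)
      sdiff_subset
  filter_upwards [hv ((isOpen_image_compl_union e hclosed disjoint_sdiff_right).mem_nhds
    (.inr ⟨e, fun _ _ => rfl, rfl⟩))]
  rintro i (⟨y, hy, hyi⟩ | ⟨g, -, hg⟩)
  · obtain rfl := ofPoint_injective hyi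
    by_contra hi
    exact hy ⟨mem_range_self i, hi⟩
  · exact (ofEnd_notMem_range_ofPoint g ⟨_, hg.symm⟩).elim

theorem tendsto_ofPoint_of_isPreconnected {D : ℕ → Set Y} (hD : ∀ i, IsPreconnected (D i))
    (hcross : ∀ A A' : Set Y, IsCompact A → IsCompact A' → Disjoint A A' →
      ∀ᶠ i in atTop, Disjoint (D i) A ∨ Disjoint (D i) A')
    {v x : ℕ → Y} (hvD : ∀ i, v i ∈ D i) (hxD : ∀ i, x i ∈ D i) {y : EndCompactification K}
    (hv : Tendsto (fun i => ofPoint (v i)) atTop (𝓝 y)) :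
    Tendsto (fun i => ofPoint (x i)) atTop (𝓝 y) := by
  refine tendsto_nhds.2 fun U hU hyU => ?_
  cases y with
  | ofPoint q =>
    obtain ⟨N', hN', hqN', hN'U⟩ := exists_compact_subset hU.1 hyU
    obtain ⟨N, hN, hqN, hNN'⟩ := exists_compact_subset isOpen_interior hqN'
    have hvN : ∀ᶠ i in atTop, v i ∈ interior N :=
      (isOpenEmbedding_ofPoint.tendsto_nhds_iff.2 hv) (isOpen_interior.mem_nhds hqN)
    filter_upwards [eventually_subset_of_inter_nonempty hD hcross hN hN' hNN', hvN] with i hi hvi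
    exact hN'U (hi ⟨v i, hvD i, interior_subset hvi⟩ (hxD i))
  | ofEnd e =>
    obtain ⟨m, hm⟩ := hU.2 e hyU
    filter_upwards [eventually_subset_of_inter_nonempty hD hcross (K.isCompact m)
      (K.isCompact (m + 1)) (K.subset_interior_succ m),
      tendsto_cocompact_of_tendsto_ofEnd hv (K.isCompact (m + 1)).compl_mem_cocompact,
      eventually_mem_comp_of_tendsto_ofEnd hv m] with i hi hvi hvm
    have hDK : Disjoint (D i) (K m) := by
      by_contra h
      exact hvi (hi (not_disjoint_iff_nonempty_inter.1 h) (hvD i))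
    exact hm (.inl ⟨x i, e.subset_comp_of_mem (hD i) hDK (hvD i) hvm (hxD i), rfl⟩)

end EndCompactification

section EndInclusion

variable {X : Type*} [TopologicalSpace X] {Ω : Opens X}
  {K : CompactExhaustion (closure (Ω : Set X))}

theorem isEmbedding_endInclusion : IsEmbedding (endInclusion Ω K) :=
  EndCompactification.isOpenEmbedding_ofPoint.isEmbedding.comp (.inclusion subset_closure)

theorem tendsto_cocompact_of_tendsto_endInclusion [T2Space X] {y : EndCompactification K}
    (hy : y ∈ endBoundary Ω K) {α : Type*} {l : Filter α} {v : α → Ω}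
    (hv : Tendsto (fun i => endInclusion Ω K (v i)) l (𝓝 y)) : Tendsto v l (cocompact Ω) := by
  refine tendsto_cocompact_of_notMem_range (fun Q hQ => ?_) hy hv
  have := EndCompactification.isClosed_image_ofPoint (K := K)
    (hQ.image (continuous_inclusion subset_closure))
  rwa [image_image] at this

end EndInclusion

section SmallAtInfinity

variable {E : Type*} [NormedAddCommGroup E] [NormedSpace ℂ E]
  {X : Type*} [TopologicalSpace X] [ChartedSpace E X] {Ω : Opens X}

theorem exists_mem_frontier_of_ultrafilter_le_cocompact {X : Type*} [TopologicalSpace X]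
    {Ω : Opens X} [WeaklyLocallyCompactSpace Ω] {A : Set X} (hA : IsCompact A) (h : Ultrafilter Ω)
    (hle : (h : Filter Ω) ≤ cocompact Ω) (hhA : ∀ᶠ u : Ω in h, (u : X) ∈ A) :
    ∃ a ∈ A, a ∈ frontier (Ω : Set X) ∧ (h : Filter Ω) ≤ comap Subtype.val (𝓝 a) := by
  obtain ⟨a, ha, hlim⟩ := hA.ultrafilter_le_nhds' (h.map Subtype.val) hhA
  have hcomap : (h : Filter Ω) ≤ comap Subtype.val (𝓝 a) := map_le_iff_le_comap.1 hlim
  refine ⟨a, ha, ⟨mem_closure_of_tendsto hlim (.of_forall Subtype.prop), fun haΩ => ?_⟩, hcomap⟩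
  rw [Ω.isOpen.interior_eq] at haΩ
  have hnhds : (h : Filter Ω) ≤ 𝓝 ⟨a, haΩ⟩ := by rwa [nhds_subtype_eq_comap]
  exact h.neBot.ne (disjoint_self.1 ((disjoint_nhds_cocompact _).mono hnhds hle))

theorem BoundaryDivergence.eventually_lt [WeaklyLocallyCompactSpace Ω]
    (hdiv : BoundaryDivergence E Ω) {A A' : Set X} (hA : IsCompact A) (hA' : IsCompact A')
    (hAA' : Disjoint A A') (c : ℝ) :
    ∀ᶠ q : Ω × Ω in cocompact Ω ×ˢ cocompact Ω,
      (q.1 : X) ∈ A → (q.2 : X) ∈ A' → c < kobayashiDist E q.1 q.2 := by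
  refine mem_iff_ultrafilter.2 fun g hg => ?_
  by_contra hnot
  have hbad := Ultrafilter.eventually_not.2 hnot
  obtain ⟨a, ha, haΩ, hga⟩ := exists_mem_frontier_of_ultrafilter_le_cocompact hA
    (g.map Prod.fst) (tendsto_fst.mono_left hg) (hbad.mono fun q hq => by
      by_contra h; exact hq fun h' => (h h').elim)
  obtain ⟨a', ha', haΩ', hga'⟩ := exists_mem_frontier_of_ultrafilter_le_cocompact hA'
    (g.map Prod.snd) (tendsto_snd.mono_left hg) (hbad.mono fun q hq => by
      by_contra h; exact hq fun _ h' => (h h').elim)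
  have hlim := (hdiv a haΩ a' haΩ' (hAA'.ne_of_mem ha ha')).mono_left (le_prod.2 ⟨hga, hga'⟩)
  obtain ⟨q, hq, hqc⟩ := (hbad.and (hlim.eventually_gt_atTop c)).exists
  exact hq fun _ _ => hqc

theorem eventually_ball_subset_of_tendsto_cobounded {M : Type*} [PseudoMetricSpace M] {α : Type*}
    {l : Filter α} {v : α → M} (hv : Tendsto v l (Bornology.cobounded M)) (R : ℝ) {t : Set M}
    (ht : t ∈ Bornology.cobounded M) : ∀ᶠ i in l, Metric.ball (v i) R ⊆ t := by
  have hfar : (Metric.thickening R tᶜ)ᶜ ∈ Bornology.cobounded M :=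
    Bornology.isBounded_def.1 (Bornology.isBounded_compl_iff.2 ht).thickening
  filter_upwards [hv.eventually_mem hfar] with i hi u hu
  by_contra hut
  exact hi (Metric.mem_thickening_iff.2 ⟨u, hut, Metric.mem_ball'.1 hu⟩)

variable [T2Space X] [IsManifold 𝓘(ℂ, E) 1 Ω] [PreconnectedSpace Ω] [LocallyCompactSpace Ω]

theorem BoundaryDivergence.eventually_disjoint_or_disjoint (hhyp : KobayashiHyperbolic E Ω)
    (hcomplete : KobayashiComplete E Ω) (hdiv : BoundaryDivergence E Ω) {α : Type*} {l : Filter α}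
    {v : α → Ω} (hv : Tendsto v l (cocompact Ω)) {C : α → Set Ω} {R : ℝ}
    (hC : ∀ i, ∀ u ∈ C i, kobayashiDist E (v i) u < R) {A A' : Set X} (hA : IsCompact A)
    (hA' : IsCompact A') (hAA' : Disjoint A A') :
    ∀ᶠ i in l, Disjoint (Subtype.val '' C i) A ∨ Disjoint (Subtype.val '' C i) A' := by
  let := hhyp.metricSpace
  have := hcomplete.properSpace hhyp
  obtain ⟨t, ht, hfar⟩ := eventually_prod_self_iff
    (r := fun u u' : Ω => (u : X) ∈ A → (u' : X) ∈ A' → R + R < kobayashiDist E u u').1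
    (hdiv.eventually_lt hA hA' hAA' (R + R))
  rw [← Metric.cobounded_eq_cocompact] at hv ht
  filter_upwards [eventually_ball_subset_of_tendsto_cobounded hv R ht] with i hi
  have hCt : C i ⊆ t := fun u hu => hi (Metric.mem_ball'.2 (hC i u hu))
  by_contra! h
  simp only [not_disjoint_iff_nonempty_inter] at h
  obtain ⟨⟨_, ⟨u, hu, rfl⟩, huA⟩, ⟨_, ⟨u', hu', rfl⟩, huA'⟩⟩ := h
  have huu' := kobayashiDist_triangle E u (v i) u'
  rw [kobayashiDist_comm E u (v i)] at huu'
  linarith [hfar u (hCt hu) u' (hCt hu') huA huA', hC i u hu, hC i u' hu']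

theorem BoundaryDivergence.isSmallAtInfinity {K : CompactExhaustion (closure (Ω : Set X))}
    (hhyp : KobayashiHyperbolic E Ω) (hcomplete : KobayashiComplete E Ω)
    (hdiv : BoundaryDivergence E Ω) :
    letI := hhyp.metricSpace; IsSmallAtInfinity (endInclusion Ω K) := by
  intro y hy v x R hvx hv
  have : WeaklyLocallyCompactSpace (closure (Ω : Set X)) :=
    ⟨fun z => let ⟨n, hn⟩ := K.exists_mem_nhds z; ⟨K n, K.isCompact n, hn⟩⟩
  have hpath : ∀ i, ∃ C : Set Ω, IsPreconnected C ∧ v i ∈ C ∧ x i ∈ C ∧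
      ∀ u ∈ C, kobayashiDist E (v i) u < R + 1 := fun i =>
    exists_isPreconnected_of_kobayashiDist_lt ((hvx i).trans_lt (lt_add_one R))
  choose C hC hvC hxC hCR using hpath
  refine EndCompactification.tendsto_ofPoint_of_isPreconnected
    (D := fun i => inclusion subset_closure '' C i)
    (fun i => (hC i).image _ (continuous_inclusion subset_closure).continuousOn)
    (fun A A' hA hA' hAA' => ?_) (fun i => mem_image_of_mem _ (hvC i))
    (fun i => mem_image_of_mem _ (hxC i)) hv
  filter_upwards [hdiv.eventually_disjoint_or_disjoint hhyp hcomplete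
    (tendsto_cocompact_of_tendsto_endInclusion hy hv) hCR (hA.image continuous_subtype_val)
    (hA'.image continuous_subtype_val) ((disjoint_image_iff Subtype.val_injective).2 hAA')]
    with i hi
  have hval : ∀ S : Set (closure (Ω : Set X)), Disjoint (Subtype.val '' C i) (Subtype.val '' S) →
      Disjoint (inclusion subset_closure '' C i) S := fun S h =>
    (disjoint_image_iff Subtype.val_injective).1 (by rwa [image_image])
  exact hi.imp (hval A) (hval A')

end SmallAtInfinity

theorem theorem1p5_general {E : Type*} [NormedAddCommGroup E] [NormedSpace ℂ E]
    {X : Type*} [TopologicalSpace X] [T2Space X] [ChartedSpace E X] [IsManifold 𝓘(ℂ, E) 1 X]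
    (Ω : Opens X) [LocallyCompactSpace Ω] [PreconnectedSpace Ω]
    (K : CompactExhaustion (closure (Ω : Set X))) [SeqCompactSpace (EndCompactification K)]
    (hhyp : KobayashiHyperbolic E Ω) (hcomplete : KobayashiComplete E Ω)
    (hdiv : BoundaryDivergence E Ω) (p : Ω)
    (hsing : ∀ x ∈ endBoundary Ω K,
      (⋂ (R : ℝ) (_ : 0 < R),
        closure (endInclusion Ω K '' bigHorosphere E Ω K p x R)).Subsingleton)
    (f : Ω → Ω) (hf : ∀ z w, kobayashiDist E (f z) (f w) ≤ kobayashiDist E z w) :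
    (∀ z : Ω, IsCompact (closure (range fun n : ℕ => f^[n] z))) ∨
    ∃ y ∈ endBoundary Ω K,
      Tendsto (fun n : ℕ => (endInclusion Ω K).comp
          ⟨f^[n], (hhyp.continuous_of_kobayashiDist_map_le hf).iterate n⟩) atTop
        (𝓝 (ContinuousMap.const Ω y)) := by
  let := hhyp.metricSpace
  have := hcomplete.properSpace hhyp
  refine isCompact_closure_orbit_or_tendsto_iterate hhyp.isLengthMetric
    isEmbedding_endInclusion.isInducing (hdiv.isSmallAtInfinity hhyp hcomplete) (p := p)
    (fun x hx => (hsing x hx).anti ?_) (hhyp.lipschitzWith_one hf)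
  exact fun y hy => mem_iInter₂.2 fun R _ => mem_iInter.1 hy (1 / 2 * Real.log R)

theorem theorem1p5 {E : Type*} [NormedAddCommGroup E] [NormedSpace ℂ E] [FiniteDimensional ℂ E]
    {X : Type*} [TopologicalSpace X] [T2Space X] [SecondCountableTopology X]
    [ChartedSpace E X] [IsManifold 𝓘(ℂ, E) ω X]
    (Ω : Opens X) (hconn : IsConnected (Ω : Set X)) (hne : (Ω : Set X) ≠ univ)
    (K : CompactExhaustion (closure (Ω : Set X))) (hseq : SeqCompactSpace (EndCompactification K))
    (hhyp : KobayashiHyperbolic E Ω) (hcomplete : KobayashiComplete E Ω)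
    (hdiv : BoundaryDivergence E Ω)
    (p : Ω)
    (hsing : ∀ x ∈ endBoundary Ω K, ∃ y : EndCompactification K,
      (⋂ (R : ℝ) (_ : 0 < R), closure (endInclusion Ω K '' bigHorosphere E Ω K p x R)) = {y})
    (f : Ω → Ω) (hf : MDifferentiable 𝓘(ℂ, E) 𝓘(ℂ, E) f) :
    (∀ z : Ω, IsCompact (closure (range fun n : ℕ => f^[n] z))) ∨
    ∃ y ∈ endBoundary Ω K,
      Tendsto (fun n : ℕ => (endInclusion Ω K).comp ⟨f^[n], hf.continuous.iterate n⟩) atTop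
        (𝓝 (ContinuousMap.const Ω y)) := by
  have := Manifold.locallyCompact_of_finiteDimensional (M := Ω) 𝓘(ℂ, E)
  have := isPreconnected_iff_preconnectedSpace.1 hconn.isPreconnected
  exact theorem1p5_general Ω K hhyp hcomplete hdiv p
    (fun x hx => (exists_eq_singleton_iff_nonempty_subsingleton.1 (hsing x hx)).2) f
    (kobayashiDist_map_le hf)
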